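/- Let $1<p<N$, let $\Omega\subset\mathbb{R}^N$ be open and bounded, and let $F:\Omega\times(0,\infty)\to[0,\infty)$ be a Carathéodory function (that is, $F(\cdot,s)$ is measurable for every $s>0$ and $F(x,\cdot)$ is continuous for a.e. $x\in\Omega$). Consider the problem $$-\Delta_p u=F(x,u)\ \text{ in }\Omega,\qquad u>0\ \text{ in }\Omega,\qquad u=0\ \text{ on }\partial\Omega, \tag{P}$$ where $\Delta_p u=\operatorname{div}(|\nabla u|^{p-2}\nabla u)$. A weak solution of (P) is an a.e. positive function $u\in W^{1,p}_0(\Omega)$ such that $F(\cdot,u)\in L^1_{\mathrm{loc}}(\Omega)$ and $$\int_\Omega|\nabla u|^{p-2}\nabla u\cdot\nabla\varphi=\int_\Omega F(x,u)\,\varphi\qquad\text{for all }\varphi\in C^1_c(\Omega).$$ If for a.e. $x\in\Omega$ the function $s\mapsto F(x,s)\,s^{1-p}$ is strictly decreasing on $(0,\infty)$, then (P) has at most one weak solution (any two weak solutions are equal a.e. in $\Omega$). In particular, for measurable $f,g:\Omega\to[0,\infty)$ and $\gamma\ge 0$, problem (P) has at most one weak solution in each of the following two cases: 1. $F(x,s)=\dfrac{f(x)}{s^{\gamma}}+g(x)s^{q}$,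 where $0\le q<p-1$ and $f+g>0$ a.e. in $\Omega$; 2. $F(x,s)=\dfrac{f(x)}{s^{\gamma}}+g(x)s^{p-1}$, where $f>0$ a.e. in $\Omega$. -/

import Mathlib

open MeasureTheory Filter Topology Set
open scoped ContDiff

/-- `φ ∈ C^k_c(Ω)`: `φ` is of class `C^k` and its support is a compact subset of `Ω`
(functions in `C^k_c(Ω)` are identified with their extension by zero). -/
def IsCkc {N : ℕ} (k : WithTop ℕ∞) (Ω : Set (EuclideanSpace ℝ (Fin N)))
    (φ : EuclideanSpace ℝ (Fin N) → ℝ) : Prop :=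
  ContDiff ℝ k φ ∧ HasCompactSupport φ ∧ tsupport φ ⊆ Ω

/-- `G` is the weak (distributional) gradient of `u` in the open set `Ω`. -/
structure HasWeakGradient {N : ℕ} (Ω : Set (EuclideanSpace ℝ (Fin N)))
    (u : EuclideanSpace ℝ (Fin N) → ℝ)
    (G : EuclideanSpace ℝ (Fin N) → EuclideanSpace ℝ (Fin N)) : Prop where
  locallyIntegrable : LocallyIntegrableOn u Ω volume
  locallyIntegrable_grad : LocallyIntegrableOn G Ω volume
  integral_eq : ∀ φ : EuclideanSpace ℝ (Fin N) → ℝ, IsCkc ∞ Ω φ →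
    ∫ x in Ω, u x • gradient φ x = -∫ x in Ω, φ x • G x

/-- `u ∈ W^{1,p}(Ω)`, with weak gradient `G`. -/
structure MemW1pWithGradient {N : ℕ} (p : ℝ) (Ω : Set (EuclideanSpace ℝ (Fin N)))
    (u : EuclideanSpace ℝ (Fin N) → ℝ)
    (G : EuclideanSpace ℝ (Fin N) → EuclideanSpace ℝ (Fin N)) : Prop where
  memLp : MemLp u (ENNReal.ofReal p) (volume.restrict Ω)
  memLp_grad : MemLp G (ENNReal.ofReal p) (volume.restrict Ω)
  hasWeakGradient : HasWeakGradient Ω u G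

/-- `u ∈ W^{1,p}_0(Ω)`, with weak gradient `G` (unique up to a null set): `u ∈ W^{1,p}(Ω)` is a
limit, in the norm of `W^{1,p}(Ω)`, of functions in `C^∞_c(Ω)`. -/
structure MemW1pZeroWithGradient {N : ℕ} (p : ℝ) (Ω : Set (EuclideanSpace ℝ (Fin N)))
    (u : EuclideanSpace ℝ (Fin N) → ℝ)
    (G : EuclideanSpace ℝ (Fin N) → EuclideanSpace ℝ (Fin N)) : Prop where
  memW1p : MemW1pWithGradient p Ω u G
  exists_approx : ∃ φ : ℕ → EuclideanSpace ℝ (Fin N) → ℝ, (∀ n, IsCkc ∞ Ω (φ n)) ∧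
    Tendsto (fun n => eLpNorm (fun x => φ n x - u x) (ENNReal.ofReal p) (volume.restrict Ω))
      atTop (𝓝 0) ∧
    Tendsto (fun n => eLpNorm (fun x => gradient (φ n) x - G x) (ENNReal.ofReal p)
      (volume.restrict Ω)) atTop (𝓝 0)

/-- `F : Ω × (0, ∞) → ℝ` is a Carathéodory function: (Lebesgue) measurable in `x` for every `s`,
continuous in `s` for almost every `x`. Values at `x ∉ Ω` or `s ≤ 0` play no role. -/
structure IsCaratheodory {N : ℕ} (Ω : Set (EuclideanSpace ℝ (Fin N)))
    (F : EuclideanSpace ℝ (Fin N) → ℝ → ℝ) : Prop where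
  aemeasurable : ∀ s : ℝ, 0 < s → AEMeasurable (fun x => F x s) (volume.restrict Ω)
  continuousOn : ∀ᵐ x ∂(volume.restrict Ω), ContinuousOn (F x) (Ioi 0)

/-- `u` is a weak solution of `-Δ_p u = F(x, u)` in `Ω`, `u > 0` in `Ω`, `u = 0` on `∂Ω`:
`u ∈ W^{1,p}_0(Ω)` is positive (almost everywhere) in `Ω`, `F(x, u) ∈ L^1_loc(Ω)`, and the
equation holds when tested with every function in `C^1_c(Ω)`. -/
def IsWeakSolution {N : ℕ} (p : ℝ) (Ω : Set (EuclideanSpace ℝ (Fin N)))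
    (F : EuclideanSpace ℝ (Fin N) → ℝ → ℝ) (u : EuclideanSpace ℝ (Fin N) → ℝ) : Prop :=
  (∀ᵐ x ∂(volume.restrict Ω), 0 < u x) ∧
  LocallyIntegrableOn (fun x => F x (u x)) Ω volume ∧
  ∃ G : EuclideanSpace ℝ (Fin N) → EuclideanSpace ℝ (Fin N),
    MemW1pZeroWithGradient p Ω u G ∧
    ∀ φ : EuclideanSpace ℝ (Fin N) → ℝ, IsCkc 1 Ω φ →
      ∫ x in Ω, ‖G x‖ ^ (p - 2) * inner ℝ (G x) (gradient φ x) = ∫ x in Ω, F x (u x) * φ x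

/-- The problem `-Δ_p u = F(x, u)`, `u > 0` in `Ω`, `u = 0` on `∂Ω` has at most one weak solution,
as an element of `W^{1,p}_0(Ω)`, that is, up to equality almost everywhere in `Ω`. -/
def AtMostOneWeakSolution {N : ℕ} (p : ℝ) (Ω : Set (EuclideanSpace ℝ (Fin N)))
    (F : EuclideanSpace ℝ (Fin N) → ℝ → ℝ) : Prop :=
  ∀ u v : EuclideanSpace ℝ (Fin N) → ℝ, IsWeakSolution p Ω F u → IsWeakSolution p Ω F v →
    u =ᵐ[volume.restrict Ω] v

/-! The proof is the Díaz–Saá / Brezis–Oswald argument, based on the hidden convexity of the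
`p`-Dirichlet energy: along the path `σ_t = ((1 - t) u ^ p + t v ^ p) ^ (1 / p)` one has
`|∇σ_t| ^ p ≤ (1 - t) |∇u| ^ p + t |∇v| ^ p`. Write `f_u = F(x, u)`, `A = ∫ |∇u| ^ p` and
`B = ∫ |∇v| ^ p`.

Testing the equation of `u` with `σ_t` and using Young's inequality gives
`∫ f_u σ_t ≤ A + (t / p) (B - A)` (`IsWeakPFlux.integral_mul_mean_le`), and testing it with `u` gives
`∫ f_u u = A` (`IsWeakPFlux.integral_mul_self`). Subtracting, dividing by `t` and letting `t → 0`
yields the integrated Picone inequality `∫ f_u u ^ (1 - p) v ^ p ≤ B`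
(`IsWeakPFlux.integral_mul_rpow_le`). Adding the same inequality with the roles of `u` and `v`
exchanged,
`∫ (f_u u ^ (1 - p) - f_v v ^ (1 - p)) (v ^ p - u ^ p) ≤ 0`,
where the integrand is nonnegative and vanishes only where `u = v`, because `F(x, s) s ^ (1 - p)`
is strictly decreasing.

Neither `u` nor `σ_t` is a `C^1_c` test function. No chain rule for weak derivatives is needed,
however: `u` and `v` are replaced by approximations `φ`, `ψ` in `C^∞_c(Ω)`, the mean is regularized
at the origin (`powerMean`), and since `f_u ≥ 0`, Fatou's lemma passes to the limit in the
inequalities. The equality `∫ f_u u = A` is obtained in the same spirit: the equation controls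
`∫ f_u |φ|` by `‖∇φ‖_p` (`IsWeakPFlux.integral_mul_abs_le`), so an approximating sequence of `u`
also converges in `L^1(f_u dx)`. -/

/-! ### A regularized weighted power mean -/

/-- The weighted `p`-mean of `|a|` and `|b|`, regularized by `δ > 0` so as to be of class `C^1` at
the origin and shifted by `-δ` so as to vanish there. Composed with two functions in `C^∞_c(Ω)` it
therefore yields a function in `C^1_c(Ω)`. -/
noncomputable def powerMean (p t δ a b : ℝ) : ℝ :=
  ((1 - t) * |a| ^ p + t * |b| ^ p + δ ^ p) ^ (1 / p) - δ

lemma powerMean_nonneg {p t δ : ℝ} (hp : 0 < p) (ht0 : 0 ≤ t) (ht1 : t ≤ 1) (hδ : 0 ≤ δ)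
    (a b : ℝ) : 0 ≤ powerMean p t δ a b := by
  have h1 : 0 ≤ 1 - t := by linarith
  have h : δ ^ p ≤ (1 - t) * |a| ^ p + t * |b| ^ p + δ ^ p := by
    have : 0 ≤ (1 - t) * |a| ^ p + t * |b| ^ p := by positivity
    linarith
  have h2 := Real.rpow_le_rpow (by positivity) h (by positivity : 0 ≤ 1 / p)
  rw [← Real.rpow_mul hδ, mul_one_div_cancel hp.ne', Real.rpow_one] at h2
  exact sub_nonneg.2 h2

lemma powerMean_zero_zero {p t δ : ℝ} (hp : 0 < p) (hδ : 0 ≤ δ) : powerMean p t δ 0 0 = 0 := by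
  simp only [powerMean, abs_zero, Real.zero_rpow hp.ne', mul_zero, zero_add]
  rw [← Real.rpow_mul hδ, mul_one_div_cancel hp.ne', Real.rpow_one, sub_self]

lemma tendsto_powerMean {p t : ℝ} (hp : 0 < p) {ι : Type*} {l : Filter ι} {δ a b : ι → ℝ}
    {a₀ b₀ : ℝ} (hδ : Tendsto δ l (𝓝 0)) (ha : Tendsto a l (𝓝 a₀)) (hb : Tendsto b l (𝓝 b₀)) :
    Tendsto (fun i => powerMean p t (δ i) (a i) (b i)) l
      (𝓝 (((1 - t) * |a₀| ^ p + t * |b₀| ^ p) ^ (1 / p))) := by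
  have h := ((((ha.abs.rpow_const (Or.inr hp.le)).const_mul (1 - t)).add
    ((hb.abs.rpow_const (Or.inr hp.le)).const_mul t)).add
    (hδ.rpow_const (Or.inr hp.le))).rpow_const (p := 1 / p) (Or.inr (by positivity))
  simpa [powerMean, Real.zero_rpow hp.ne'] using h.sub hδ

/-! ### Test functions and their gradients -/

section Gradient

variable {N : ℕ} {Ω : Set (EuclideanSpace ℝ (Fin N))} {p t δ : ℝ}
  {φ ψ : EuclideanSpace ℝ (Fin N) → ℝ}

lemma norm_gradient (φ : EuclideanSpace ℝ (Fin N) → ℝ) (x : EuclideanSpace ℝ (Fin N)) :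
    ‖gradient φ x‖ = ‖fderiv ℝ φ x‖ := by
  rw [← toDual_gradient, LinearIsometryEquiv.norm_map]

lemma IsCkc.powerMean (hp : 1 < p) (ht0 : 0 ≤ t) (ht1 : t ≤ 1) (hδ : 0 < δ)
    (hφ : IsCkc ∞ Ω φ) (hψ : IsCkc ∞ Ω ψ) :
    IsCkc 1 Ω (fun x => powerMean p t δ (φ x) (ψ x)) := by
  have h1 : 0 ≤ 1 - t := by linarith
  have hsupp : Function.support (fun x => _root_.powerMean p t δ (φ x) (ψ x)) ⊆
      tsupport φ ∪ tsupport ψ := by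
    intro x hx
    by_contra h
    simp only [mem_union, not_or] at h
    apply hx
    simp only [image_eq_zero_of_notMem_tsupport h.1, image_eq_zero_of_notMem_tsupport h.2]
    exact powerMean_zero_zero (by linarith) hδ.le
  have hK : IsCompact (tsupport φ ∪ tsupport ψ) := hφ.2.1.isCompact.union hψ.2.1.isCompact
  refine ⟨?_, HasCompactSupport.of_support_subset_isCompact hK hsupp,
    (closure_minimal hsupp hK.isClosed).trans (union_subset hφ.2.2 hψ.2.2)⟩
  refine ContDiff.sub (ContDiff.rpow_const_of_ne ?_ fun x => ?_) contDiff_const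
  · have a1 := (hφ.1.of_le (by simp : (1 : WithTop ℕ∞) ≤ ∞)).norm_rpow hp
    have b1 := (hψ.1.of_le (by simp : (1 : WithTop ℕ∞) ≤ ∞)).norm_rpow hp
    simp only [Real.norm_eq_abs] at a1 b1
    exact ((contDiff_const.mul a1).add (contDiff_const.mul b1)).add contDiff_const
  · positivity

/-- The gradient of a regularized mean, with weights `α = |φ| / S` and `β = |ψ| / S`, where
`S = ((1 - t) |φ| ^ p + t |ψ| ^ p + δ ^ p) ^ (1 / p)`. -/
lemma exists_norm_gradient_powerMean_le (hp : 1 < p) (ht0 : 0 ≤ t) (ht1 : t ≤ 1) (hδ : 0 < δ)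
    (hφ : Differentiable ℝ φ) (hψ : Differentiable ℝ ψ) (x : EuclideanSpace ℝ (Fin N)) :
    ∃ α β : ℝ, 0 ≤ α ∧ 0 ≤ β ∧ (1 - t) * α ^ p + t * β ^ p ≤ 1 ∧
      ‖gradient (fun x => powerMean p t δ (φ x) (ψ x)) x‖ ≤
        (1 - t) * (α ^ (p - 1) * ‖gradient φ x‖) + t * (β ^ (p - 1) * ‖gradient ψ x‖) := by
  have h1 : 0 ≤ 1 - t := by linarith
  have hp0 : 0 < p := by linarith
  set Q : EuclideanSpace ℝ (Fin N) → ℝ :=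
    fun x => (1 - t) * |φ x| ^ p + t * |ψ x| ^ p + δ ^ p with hQ
  have hQx : 0 < Q x := by positivity
  -- `s` is the inverse of the unshifted mean at `x`
  set s := Q x ^ (-(1 / p)) with hs
  have hs0 : 0 < s := by positivity
  have hsp : s ^ p = (Q x)⁻¹ := by
    rw [hs, ← Real.rpow_mul hQx.le, ← Real.rpow_neg_one]; congr 1; field_simp
  have hsp1 : s ^ (p - 1) = Q x ^ (1 / p - 1) := by
    rw [hs, ← Real.rpow_mul hQx.le]; congr 1; field_simp; ring
  refine ⟨s * |φ x|, s * |ψ x|, by positivity, by positivity, ?_, ?_⟩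
  · rw [Real.mul_rpow hs0.le (abs_nonneg _), Real.mul_rpow hs0.le (abs_nonneg _), hsp]
    have : (1 - t) * ((Q x)⁻¹ * |φ x| ^ p) + t * ((Q x)⁻¹ * |ψ x| ^ p)
        = (Q x)⁻¹ * ((1 - t) * |φ x| ^ p + t * |ψ x| ^ p) := by ring
    rw [this, inv_mul_le_one₀ hQx]
    have : 0 ≤ δ ^ p := by positivity
    simp only [hQ]; linarith
  · have da := (hφ.norm_rpow hp x).hasFDerivAt
    have db := (hψ.norm_rpow hp x).hasFDerivAt
    have na := norm_fderiv_norm_rpow_le hφ (x := x) hp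
    have nb := norm_fderiv_norm_rpow_le hψ (x := x) hp
    simp only [Real.norm_eq_abs] at da db na nb
    have dQ : HasFDerivAt Q _ x := ((da.const_mul (1 - t)).add (db.const_mul t)).add_const (δ ^ p)
    have dS := (dQ.rpow_const (p := 1 / p) (Or.inl hQx.ne')).sub_const δ
    have e : (fun x => powerMean p t δ (φ x) (ψ x)) = fun x => Q x ^ (1 / p) - δ := rfl
    rw [norm_gradient, norm_gradient, norm_gradient, e, dS.fderiv, norm_smul,
      Real.mul_rpow hs0.le (abs_nonneg _), Real.mul_rpow hs0.le (abs_nonneg _), hsp1,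
      Real.norm_of_nonneg (by positivity)]
    calc 1 / p * Q x ^ (1 / p - 1) * _
        ≤ 1 / p * Q x ^ (1 / p - 1) * ((1 - t) * (p * |φ x| ^ (p - 1) * ‖fderiv ℝ φ x‖)
            + t * (p * |ψ x| ^ (p - 1) * ‖fderiv ℝ ψ x‖)) := by
          gcongr
          refine (norm_add_le _ _).trans ?_
          rw [norm_smul, norm_smul, Real.norm_of_nonneg h1, Real.norm_of_nonneg ht0]
          gcongr
      _ = _ := by field_simp

lemma IsCkc.differentiable {k : WithTop ℕ∞} (hk : 1 ≤ k) (hφ : IsCkc k Ω φ) :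
    Differentiable ℝ φ := hφ.1.differentiable (by rintro rfl; simp at hk)

lemma IsCkc.one {φ : EuclideanSpace ℝ (Fin N) → ℝ} (hφ : IsCkc ∞ Ω φ) : IsCkc 1 Ω φ :=
  ⟨hφ.1.of_le (by simp), hφ.2⟩

lemma IsCkc.memLp_gradient {k : WithTop ℕ∞} (hk : 1 ≤ k) (hφ : IsCkc k Ω φ) (q : ENNReal) :
    MemLp (gradient φ) q (volume.restrict Ω) := by
  refine MemLp.restrict Ω (Continuous.memLp_of_hasCompactSupport ?_ ?_)
  · exact (InnerProductSpace.toDual ℝ _).symm.continuous.comp (hφ.1.continuous_fderiv (by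
      rintro rfl; simp at hk))
  · exact (hφ.2.1.fderiv (𝕜 := ℝ)).comp_left (map_zero (InnerProductSpace.toDual ℝ _).symm)

lemma IsCkc.sub {k : WithTop ℕ∞} (hφ : IsCkc k Ω φ) (hψ : IsCkc k Ω ψ) :
    IsCkc k Ω (fun x => φ x - ψ x) :=
  ⟨hφ.1.sub hψ.1, hφ.2.1.sub hψ.2.1,
    (tsupport_sub φ ψ).trans (union_subset hφ.2.2 hψ.2.2)⟩

lemma gradient_fun_sub (hφ : Differentiable ℝ φ) (hψ : Differentiable ℝ ψ) :
    gradient (fun x => φ x - ψ x) = gradient φ - gradient ψ := by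
  ext1 x
  simp [gradient, fderiv_fun_sub (hφ x) (hψ x)]

lemma IsCkc.integrable_mul {k : WithTop ℕ∞} (hφ : IsCkc k Ω φ)
    {f : EuclideanSpace ℝ (Fin N) → ℝ} (hf : LocallyIntegrableOn f Ω volume) :
    Integrable (fun x => f x * φ x) (volume.restrict Ω) := by
  have h := (hf.integrableOn_compact_subset hφ.2.2 hφ.2.1.isCompact).mul_continuousOn
    hφ.1.continuous.continuousOn hφ.2.1.isCompact
  refine Integrable.restrict ?_
  rw [← integrableOn_iff_integrable_of_support_subset (s := tsupport φ)]
  · exact h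
  · exact fun x hx => subset_tsupport _ (right_ne_zero_of_mul hx)

end Gradient

/-! ### Fatou's lemma for real integrals and convergence in `L^p` -/

section MeasureTheory

variable {α E : Type*} [MeasurableSpace α] {μ : Measure α}

/-- Fatou's lemma for Bochner integrals, including the integrability of the limit. -/
lemma integrable_and_integral_le_of_tendsto {g : ℕ → α → ℝ} {h : α → ℝ} {c : ℕ → ℝ} {C : ℝ}
    (hg : ∀ n, Integrable (g n) μ) (hg0 : ∀ n, 0 ≤ᵐ[μ] g n) (hgc : ∀ n, ∫ x, g n x ∂μ ≤ c n)
    (hc : Tendsto c atTop (𝓝 C))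
    (hlim : ∀ᵐ x ∂μ, Tendsto (fun n => g n x) atTop (𝓝 (h x))) :
    Integrable h μ ∧ ∫ x, h x ∂μ ≤ C := by
  have hm : AEStronglyMeasurable h μ :=
    aestronglyMeasurable_of_tendsto_ae atTop (fun n => (hg n).1) hlim
  have h0 : 0 ≤ᵐ[μ] h := by
    filter_upwards [hlim, ae_all_iff.2 hg0] with x hx h0 using ge_of_tendsto' hx h0
  have hC : 0 ≤ C := ge_of_tendsto' hc fun n => (integral_nonneg_of_ae (hg0 n)).trans (hgc n)
  have key : ∫⁻ x, ENNReal.ofReal (h x) ∂μ ≤ ENNReal.ofReal C := by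
    calc ∫⁻ x, ENNReal.ofReal (h x) ∂μ
        = ∫⁻ x, liminf (fun n => ENNReal.ofReal (g n x)) atTop ∂μ := by
          refine lintegral_congr_ae ?_
          filter_upwards [hlim] with x hx
          exact ((ENNReal.tendsto_ofReal hx).liminf_eq).symm
      _ ≤ liminf (fun n => ∫⁻ x, ENNReal.ofReal (g n x) ∂μ) atTop :=
          lintegral_liminf_le' fun n => (hg n).1.aemeasurable.ennreal_ofReal
      _ ≤ liminf (fun n => ENNReal.ofReal (c n)) atTop := by
          refine liminf_le_liminf (Eventually.of_forall fun n => ?_)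
          rw [← ofReal_integral_eq_lintegral_ofReal (hg n) (hg0 n)]
          exact ENNReal.ofReal_le_ofReal (hgc n)
      _ = ENNReal.ofReal C := (ENNReal.tendsto_ofReal hc).liminf_eq
  have hi : Integrable h μ := (lintegral_ofReal_ne_top_iff_integrable hm h0).1
    (key.trans_lt ENNReal.ofReal_lt_top).ne
  refine ⟨hi, ?_⟩
  rw [← ofReal_integral_eq_lintegral_ofReal hi h0] at key
  exact (ENNReal.ofReal_le_ofReal_iff hC).1 key

variable [NormedAddCommGroup E] {p : ℝ}

lemma lpNorm_rpow_eq_integral (hp : 0 < p) {W : α → E} (hW : AEStronglyMeasurable W μ) :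
    lpNorm W (ENNReal.ofReal p) μ ^ p = ∫ x, ‖W x‖ ^ p ∂μ := by
  rw [lpNorm_eq_integral_norm_rpow_toReal (by simpa using hp) ENNReal.ofReal_ne_top hW,
    ENNReal.toReal_ofReal hp.le, ← Real.rpow_mul (integral_nonneg fun x => by positivity),
    inv_mul_cancel₀ hp.ne', Real.rpow_one]

lemma MeasureTheory.MemLp.integrable_norm_rpow_ofReal (hp : 0 < p) {W : α → E}
    (hW : MemLp W (ENNReal.ofReal p) μ) : Integrable (fun x => ‖W x‖ ^ p) μ := by
  have h := hW.integrable_norm_rpow (by simpa using hp) ENNReal.ofReal_ne_top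
  rwa [ENNReal.toReal_ofReal hp.le] at h

lemma tendsto_lpNorm_sub {q : ENNReal} {ι : Type*} {l : Filter ι} {W : ι → α → E} {G : α → E}
    (hW : ∀ i, MemLp (W i) q μ) (hG : MemLp G q μ)
    (h : Tendsto (fun i => eLpNorm (fun x => W i x - G x) q μ) l (𝓝 0)) :
    Tendsto (fun i => lpNorm (W i - G) q μ) l (𝓝 0) := by
  have h' := (ENNReal.tendsto_toReal ENNReal.zero_ne_top).comp h
  rw [ENNReal.toReal_zero] at h'
  refine h'.congr fun i => ?_
  rw [Function.comp_apply, ← toReal_eLpNorm ((hW i).sub hG).1]; rfl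

lemma tendsto_lpNorm_of_tendsto_sub {q : ENNReal} (hq : 1 ≤ q) {ι : Type*} {l : Filter ι}
    {W : ι → α → E} {G : α → E} (hW : ∀ i, MemLp (W i) q μ) (hG : MemLp G q μ)
    (h : Tendsto (fun i => lpNorm (W i - G) q μ) l (𝓝 0)) :
    Tendsto (fun i => lpNorm (W i) q μ) l (𝓝 (lpNorm G q μ)) := by
  rw [tendsto_iff_dist_tendsto_zero]
  refine squeeze_zero (fun _ => dist_nonneg) (fun i => ?_) h
  rw [Real.dist_eq, abs_sub_le_iff]
  have h1 := lpNorm_le_lpNorm_add_lpNorm_sub' (f := W i) hG hq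
  have h2 := lpNorm_le_lpNorm_add_lpNorm_sub (f := G) (hW i) hq
  exact ⟨by linarith, by linarith⟩

/-- Hölder's inequality for the exponents `p / (p - 1)` and `p`. -/
lemma integrable_norm_rpow_mul_norm (hp : 1 < p) {G W : α → E}
    (hG : MemLp G (ENNReal.ofReal p) μ) (hW : MemLp W (ENNReal.ofReal p) μ) :
    Integrable (fun x => ‖G x‖ ^ (p - 1) * ‖W x‖) μ ∧
      ∫ x, ‖G x‖ ^ (p - 1) * ‖W x‖ ∂μ ≤
        lpNorm G (ENNReal.ofReal p) μ ^ (p - 1) * lpNorm W (ENNReal.ofReal p) μ := by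
  have hp0 : 0 < p := by linarith
  have hp1 : 0 < p - 1 := by linarith
  have hG' : MemLp (fun x => ‖G x‖ ^ (p - 1)) (ENNReal.ofReal (p / (p - 1))) μ := by
    have h := hG.norm_rpow_div (ENNReal.ofReal (p - 1))
    rwa [ENNReal.toReal_ofReal hp1.le, ← ENNReal.ofReal_div_of_pos hp1] at h
  have hpq : (p / (p - 1)).HolderConjugate p := (Real.HolderConjugate.conjExponent hp).symm
  refine ⟨?_, ?_⟩
  · have : ENNReal.HolderConjugate (ENNReal.ofReal (p / (p - 1))) (ENNReal.ofReal p) :=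
      hpq.ennrealOfReal
    exact hG'.integrable_mul hW.norm
  · refine (integral_mul_le_Lp_mul_Lq_of_nonneg hpq (ae_of_all _ fun x => by positivity)
      (ae_of_all _ fun x => norm_nonneg _) hG' hW.norm).trans (le_of_eq ?_)
    have e : ∀ x, (‖G x‖ ^ (p - 1)) ^ (p / (p - 1)) = ‖G x‖ ^ p := fun x => by
      rw [← Real.rpow_mul (norm_nonneg _)]; congr 1; field_simp
    simp only [e]
    rw [← lpNorm_rpow_eq_integral hp0 hG.1, ← lpNorm_rpow_eq_integral hp0 hW.1,
      ← Real.rpow_mul lpNorm_nonneg, ← Real.rpow_mul lpNorm_nonneg, mul_one_div_cancel hp0.ne',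
      Real.rpow_one]
    congr 2
    field_simp

end MeasureTheory

/-! ### Pointwise and integral bounds for the `p`-Laplacian flux -/

section PLaplacian

lemma norm_rpow_sub_two_mul_norm {E : Type*} [NormedAddCommGroup E] {p : ℝ} (hp : 1 < p) (G : E) :
    ‖G‖ ^ (p - 2) * ‖G‖ = ‖G‖ ^ (p - 1) := by
  rcases eq_or_ne G 0 with rfl | h
  · simp [Real.zero_rpow (by linarith : p - 1 ≠ 0)]
  · rw [← Real.rpow_add_one (by simpa using h)]; congr 1; ring

variable {α E : Type*} [MeasurableSpace α] {μ : Measure α} [NormedAddCommGroup E]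
  [InnerProductSpace ℝ E] {p : ℝ}

lemma abs_norm_rpow_mul_inner_le (hp : 1 < p) (G w : E) :
    |‖G‖ ^ (p - 2) * inner ℝ G w| ≤ ‖G‖ ^ (p - 1) * ‖w‖ := by
  rw [abs_mul, abs_of_nonneg (by positivity), ← norm_rpow_sub_two_mul_norm hp, mul_assoc]
  gcongr
  exact abs_real_inner_le_norm G w

lemma norm_rpow_mul_inner_self (hp : 1 < p) (G : E) :
    ‖G‖ ^ (p - 2) * inner ℝ G G = ‖G‖ ^ p := by
  rw [real_inner_self_eq_norm_mul_norm, ← mul_assoc, norm_rpow_sub_two_mul_norm hp]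
  rcases eq_or_ne G 0 with rfl | h
  · simp [Real.zero_rpow (by linarith : p ≠ 0)]
  · rw [← Real.rpow_add_one (by simpa using h)]; congr 1; ring

lemma integrable_norm_rpow_mul_inner (hp : 1 < p) {G W : α → E}
    (hG : MemLp G (ENNReal.ofReal p) μ) (hW : MemLp W (ENNReal.ofReal p) μ) :
    Integrable (fun x => ‖G x‖ ^ (p - 2) * inner ℝ (G x) (W x)) μ := by
  refine (integrable_norm_rpow_mul_norm hp hG hW).1.mono' ?_
    (ae_of_all _ fun x => abs_norm_rpow_mul_inner_le hp _ _)
  exact (hG.1.norm.aemeasurable.pow_const _).aestronglyMeasurable.mul (hG.1.inner hW.1)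

lemma abs_integral_norm_rpow_mul_inner_le (hp : 1 < p) {G W : α → E}
    (hG : MemLp G (ENNReal.ofReal p) μ) (hW : MemLp W (ENNReal.ofReal p) μ) :
    |∫ x, ‖G x‖ ^ (p - 2) * inner ℝ (G x) (W x) ∂μ| ≤
      lpNorm G (ENNReal.ofReal p) μ ^ (p - 1) * lpNorm W (ENNReal.ofReal p) μ := by
  refine abs_integral_le_integral_abs.trans (le_trans ?_ (integrable_norm_rpow_mul_norm hp hG hW).2)
  exact integral_mono (integrable_norm_rpow_mul_inner hp hG hW).abs
    (integrable_norm_rpow_mul_norm hp hG hW).1 fun x => abs_norm_rpow_mul_inner_le hp _ _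

/-- Young's inequality for `(α * g) ^ (p - 1)` and `w`. -/
lemma rpow_mul_young (hp : 1 < p) {α g w : ℝ} (hα : 0 ≤ α) (hg : 0 ≤ g) (hw : 0 ≤ w) :
    g ^ (p - 1) * (α ^ (p - 1) * w) ≤ (1 - 1 / p) * (α ^ p * g ^ p) + 1 / p * w ^ p := by
  have hp1 : 0 < p - 1 := by linarith
  have hpq : (p / (p - 1)).HolderConjugate p := (Real.HolderConjugate.conjExponent hp).symm
  have h := Real.young_inequality_of_nonneg (by positivity : 0 ≤ (α * g) ^ (p - 1)) hw hpq
  rw [← Real.rpow_mul (by positivity), mul_div_cancel₀ _ hp1.ne', Real.mul_rpow hα hg,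
    Real.mul_rpow hα hg] at h
  calc _ = α ^ (p - 1) * g ^ (p - 1) * w := by ring
    _ ≤ _ := h
    _ = _ := by field_simp

end PLaplacian

/-! ### The path of power means between two functions -/

/-- A lower bound, linear in `t`, for the mean at time `t`: it makes the difference quotients at
`t = 0` bounded below by `-a`, as Fatou's lemma requires. -/
lemma mul_le_weighted_mean {p t a : ℝ} (hp : 1 ≤ p) (ht0 : 0 ≤ t) (ht1 : t ≤ 1) (ha : 0 ≤ a)
    (b : ℝ) : (1 - t) * a ≤ ((1 - t) * |a| ^ p + t * |b| ^ p) ^ (1 / p) := by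
  have h1 : 0 ≤ 1 - t := sub_nonneg.2 ht1
  have hp0 : 0 < p := by linarith
  calc (1 - t) * a = (((1 - t) * a) ^ p) ^ (1 / p) := by
        rw [← Real.rpow_mul (by positivity), mul_one_div_cancel hp0.ne', Real.rpow_one]
    _ ≤ _ := by
        refine Real.rpow_le_rpow (by positivity) ?_ (by positivity)
        rw [Real.mul_rpow h1 ha, abs_of_nonneg ha]
        have h2 : (1 - t) ^ p ≤ 1 - t := Real.rpow_le_self_of_le_one h1 (by linarith) hp
        have h3 : 0 ≤ t * |b| ^ p := by positivity
        have h4 := mul_le_mul_of_nonneg_right h2 (by positivity : 0 ≤ a ^ p)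
        linarith

lemma tendsto_weighted_mean_slope {p a : ℝ} (hp : 0 < p) (ha : 0 < a) (b : ℝ) {t : ℕ → ℝ}
    (ht : Tendsto t atTop (𝓝[≠] 0)) :
    Tendsto (fun n => (t n)⁻¹ * (((1 - t n) * |a| ^ p + t n * |b| ^ p) ^ (1 / p) - a)) atTop
      (𝓝 (1 / p * a ^ (1 - p) * (|b| ^ p - a ^ p))) := by
  have h1 : HasDerivAt (fun t : ℝ => (1 - t) * |a| ^ p + t * |b| ^ p)
      (-1 * |a| ^ p + 1 * |b| ^ p) 0 :=
    (((hasDerivAt_id (0 : ℝ)).const_sub 1).mul_const _).add ((hasDerivAt_id (0 : ℝ)).mul_const _)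
  have hap : 0 < a ^ p := by positivity
  have h2 := (h1.rpow_const (p := 1 / p) (Or.inl (by
    simp [abs_of_pos ha, hap.ne']))).tendsto_slope_zero.comp ht
  simp only [abs_of_pos ha, sub_zero, one_mul, zero_mul, add_zero, zero_add, neg_mul,
    ← Real.rpow_mul ha.le, mul_one_div_cancel hp.ne', Real.rpow_one, smul_eq_mul,
    Function.comp_def] at h2 ⊢
  convert h2 using 2
  have e : p * (1 / p - 1) = 1 - p := by field_simp
  rw [e]; ring

/-! ### Energy estimates for weak solutions -/

section WeakSolution

variable {N : ℕ} {p : ℝ} {Ω : Set (EuclideanSpace ℝ (Fin N))}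
  {u v f : EuclideanSpace ℝ (Fin N) → ℝ}
  {G H : EuclideanSpace ℝ (Fin N) → EuclideanSpace ℝ (Fin N)}

lemma MemW1pZeroWithGradient.exists_approx_ae (hp : 1 < p)
    (hu : MemW1pZeroWithGradient p Ω u G) :
    ∃ φ : ℕ → EuclideanSpace ℝ (Fin N) → ℝ, (∀ n, IsCkc ∞ Ω (φ n)) ∧
      (∀ᵐ x ∂(volume.restrict Ω), Tendsto (fun n => φ n x) atTop (𝓝 (u x))) ∧
      Tendsto (fun n => lpNorm (gradient (φ n) - G) (ENNReal.ofReal p) (volume.restrict Ω))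
        atTop (𝓝 0) := by
  obtain ⟨φ, hφ, h0, h1⟩ := hu.exists_approx
  have hp0 : ENNReal.ofReal p ≠ 0 := by simp; linarith
  obtain ⟨ns, hns, hae⟩ := (tendstoInMeasure_of_tendsto_eLpNorm hp0
    (fun n => (hφ n).1.continuous.aestronglyMeasurable) hu.memW1p.memLp.1 h0).exists_seq_tendsto_ae
  exact ⟨fun n => φ (ns n), fun n => hφ _, hae,
    (tendsto_lpNorm_sub (fun n => (hφ n).memLp_gradient (by simp) _) hu.memW1p.memLp_grad
      h1).comp hns.tendsto_atTop⟩

/-- `-div (|G| ^ (p - 2) G) = f` weakly in `Ω`, tested with `C^1_c(Ω)`, for a field `G ∈ L^p` and a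
locally integrable `f ≥ 0`. For a weak solution `u`, `G` is its gradient and `f = F(x, u)`. -/
structure IsWeakPFlux (p : ℝ) (Ω : Set (EuclideanSpace ℝ (Fin N)))
    (G : EuclideanSpace ℝ (Fin N) → EuclideanSpace ℝ (Fin N))
    (f : EuclideanSpace ℝ (Fin N) → ℝ) : Prop where
  memLp : MemLp G (ENNReal.ofReal p) (volume.restrict Ω)
  locallyIntegrable : LocallyIntegrableOn f Ω volume
  nonneg : ∀ᵐ x ∂(volume.restrict Ω), 0 ≤ f x
  integral_eq : ∀ φ : EuclideanSpace ℝ (Fin N) → ℝ, IsCkc 1 Ω φ →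
      ∫ x in Ω, ‖G x‖ ^ (p - 2) * inner ℝ (G x) (gradient φ x) = ∫ x in Ω, f x * φ x

namespace IsWeakPFlux

/-- The right-hand side `f` acts boundedly on `W^{1,p}_0(Ω)`: test with regularizations of `|φ|`,
that is, with power means at `t = 0`. -/
lemma integral_mul_abs_le (hp : 1 < p) (h : IsWeakPFlux p Ω G f)
    {φ : EuclideanSpace ℝ (Fin N) → ℝ} (hφ : IsCkc ∞ Ω φ) :
    Integrable (fun x => f x * |φ x|) (volume.restrict Ω) ∧ ∫ x in Ω, f x * |φ x| ≤
      lpNorm G (ENNReal.ofReal p) (volume.restrict Ω) ^ (p - 1) *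
        lpNorm (gradient φ) (ENNReal.ofReal p) (volume.restrict Ω) := by
  have hp0 : 0 < p := by linarith
  set δ : ℕ → ℝ := fun n => 1 / ((n : ℝ) + 1) with hδ
  have hδ0 : ∀ n, 0 < δ n := fun n => by positivity
  have hS : ∀ n, IsCkc 1 Ω (fun x => powerMean p 0 (δ n) (φ x) (φ x)) := fun n =>
    hφ.powerMean hp le_rfl zero_le_one (hδ0 n) hφ
  have hW := hφ.memLp_gradient (by simp) (ENNReal.ofReal p)
  refine integrable_and_integral_le_of_tendsto
    (g := fun n x => f x * powerMean p 0 (δ n) (φ x) (φ x))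
    (fun n => (hS n).integrable_mul h.locallyIntegrable) (fun n => ?_) (fun n => ?_)
    tendsto_const_nhds (ae_of_all _ fun x => ?_)
  · filter_upwards [h.nonneg] with x hx
    exact mul_nonneg hx (powerMean_nonneg hp0 le_rfl zero_le_one (hδ0 n).le _ _)
  · rw [← h.integral_eq _ (hS n)]
    refine le_trans ?_ (integrable_norm_rpow_mul_norm hp h.memLp hW).2
    refine integral_mono (integrable_norm_rpow_mul_inner hp h.memLp
      ((hS n).memLp_gradient le_rfl _)) (integrable_norm_rpow_mul_norm hp h.memLp hW).1 fun x => ?_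
    refine (le_abs_self _).trans ((abs_norm_rpow_mul_inner_le hp _ _).trans ?_)
    obtain ⟨α, β, hα, -, hαβ, hle⟩ := exists_norm_gradient_powerMean_le hp le_rfl zero_le_one
      (hδ0 n) (hφ.differentiable (by simp)) (hφ.differentiable (by simp)) x
    simp only [sub_zero, one_mul, zero_mul, add_zero] at hαβ hle
    have hα1 : α ≤ 1 := by
      by_contra hlt
      exact (Real.one_lt_rpow (not_le.1 hlt) hp0).not_ge hαβ
    gcongr
    exact hle.trans (mul_le_of_le_one_left (norm_nonneg _)
      (Real.rpow_le_one hα hα1 (by linarith)))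
  · refine Tendsto.const_mul _ ?_
    have := tendsto_powerMean (t := 0) hp0 tendsto_one_div_add_atTop_nhds_zero_nat
      (tendsto_const_nhds (x := φ x)) (tendsto_const_nhds (x := φ x))
    simp only [sub_zero, one_mul, zero_mul, add_zero] at this
    rwa [← Real.rpow_mul (abs_nonneg _), mul_one_div_cancel hp0.ne', Real.rpow_one] at this

/-- The solution itself is an admissible test function: smooth approximations of `u` converge to `u`
in `L^1(f dx)`, by `integral_mul_abs_le` applied to their differences. -/
lemma integral_mul_self (hp : 1 < p) (h : IsWeakPFlux p Ω G f)
    (hu : MemW1pZeroWithGradient p Ω u G) :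
    Integrable (fun x => f x * u x) (volume.restrict Ω) ∧
      ∫ x in Ω, f x * u x = ∫ x in Ω, ‖G x‖ ^ p := by
  obtain ⟨φ, hφ, hae, hgrad⟩ := hu.exists_approx_ae hp
  have hq : 1 ≤ ENNReal.ofReal p := by simpa using hp.le
  have hW := fun n => (hφ n).memLp_gradient (by simp) (ENNReal.ofReal p)
  have hd := fun n => (hφ n).differentiable (by simp)
  set K := lpNorm G (ENNReal.ofReal p) (volume.restrict Ω) ^ (p - 1) with hK
  have key : ∀ n, Integrable (fun x => f x * |φ n x - u x|) (volume.restrict Ω) ∧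
      ∫ x in Ω, f x * |φ n x - u x| ≤
        K * lpNorm (gradient (φ n) - G) (ENNReal.ofReal p) (volume.restrict Ω) := by
    intro n
    have hA := fun m => h.integral_mul_abs_le hp ((hφ n).sub (hφ m))
    refine integrable_and_integral_le_of_tendsto (g := fun m x => f x * |φ n x - φ m x|)
      (fun m => (hA m).1) (fun m => ?_) (fun m => (hA m).2) (Tendsto.const_mul _ ?_) ?_
    · filter_upwards [h.nonneg] with x hx using by positivity
    · simp only [gradient_fun_sub (hd n) (hd _)]
      refine tendsto_lpNorm_of_tendsto_sub hq (fun m => (hW n).sub (hW m))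
        ((hW n).sub h.memLp) (hgrad.congr fun m => ?_)
      rw [sub_sub_sub_cancel_left, lpNorm_sub_comm]
    · filter_upwards [hae] with x hx
      exact ((tendsto_const_nhds.sub hx).abs).const_mul _
  have hfm : AEStronglyMeasurable f (volume.restrict Ω) := h.locallyIntegrable.aestronglyMeasurable
  have hum := hu.memW1p.memLp.1
  have hdiff : ∀ n, Integrable (fun x => f x * (φ n x - u x)) (volume.restrict Ω) := fun n => by
    refine (key n).1.mono (hfm.mul ((hφ n).1.continuous.aestronglyMeasurable.sub hum)) ?_
    exact ae_of_all _ fun x => by simp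
  have hφi := fun n => (hφ n).integrable_mul h.locallyIntegrable
  have hui : Integrable (fun x => f x * u x) (volume.restrict Ω) := by
    refine ((hφi 0).sub (hdiff 0)).congr (ae_of_all _ fun x => ?_)
    simp only [Pi.sub_apply]; ring
  have hz : Tendsto (fun n => K * lpNorm (gradient (φ n) - G) (ENNReal.ofReal p)
      (volume.restrict Ω)) atTop (𝓝 0) := by simpa using hgrad.const_mul K
  have lim1 : Tendsto (fun n => ∫ x in Ω, f x * φ n x) atTop (𝓝 (∫ x in Ω, f x * u x)) := by
    rw [tendsto_iff_dist_tendsto_zero]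
    refine squeeze_zero (fun _ => dist_nonneg) (fun n => ?_) hz
    rw [Real.dist_eq, ← integral_sub (hφi n) hui]
    refine abs_integral_le_integral_abs.trans (le_trans (le_of_eq ?_) (key n).2)
    refine integral_congr_ae ?_
    filter_upwards [h.nonneg] with x hx
    rw [← mul_sub, abs_mul, abs_of_nonneg hx]
  have lim2 : Tendsto (fun n => ∫ x in Ω, f x * φ n x) atTop (𝓝 (∫ x in Ω, ‖G x‖ ^ p)) := by
    rw [tendsto_iff_dist_tendsto_zero]
    refine squeeze_zero (fun _ => dist_nonneg) (fun n => ?_) hz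
    simp only [← norm_rpow_mul_inner_self hp]
    rw [Real.dist_eq, ← h.integral_eq _ (hφ n).one,
      ← integral_sub (integrable_norm_rpow_mul_inner hp h.memLp (hW n))
        (integrable_norm_rpow_mul_inner hp h.memLp h.memLp)]
    refine le_trans (le_of_eq ?_) (abs_integral_norm_rpow_mul_inner_le hp h.memLp
      ((hW n).sub h.memLp))
    congr 2 with x
    simp [inner_sub_right, mul_sub]
  exact ⟨hui, tendsto_nhds_unique lim1 lim2⟩

/-- Energy estimate obtained by testing with the mean of `u` and `v` at time `t`; it combines the
hidden convexity of the `p`-Dirichlet energy with Young's inequality. -/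
lemma integral_mul_mean_le (hp : 1 < p) (h : IsWeakPFlux p Ω G f)
    (hu : MemW1pZeroWithGradient p Ω u G) (hv : MemW1pZeroWithGradient p Ω v H)
    {t : ℝ} (ht0 : 0 ≤ t) (ht1 : t ≤ 1) :
    Integrable (fun x => f x * ((1 - t) * |u x| ^ p + t * |v x| ^ p) ^ (1 / p))
      (volume.restrict Ω) ∧
    ∫ x in Ω, f x * ((1 - t) * |u x| ^ p + t * |v x| ^ p) ^ (1 / p) ≤
      (1 - 1 / p) * (∫ x in Ω, ‖G x‖ ^ p) +
        1 / p * ((1 - t) * (∫ x in Ω, ‖G x‖ ^ p) + t * ∫ x in Ω, ‖H x‖ ^ p) := by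
  obtain ⟨φ, hφ, hφae, hφg⟩ := hu.exists_approx_ae hp
  obtain ⟨ψ, hψ, hψae, hψg⟩ := hv.exists_approx_ae hp
  have hp0 : 0 < p := by linarith
  have h1t : 0 ≤ 1 - t := by linarith
  have h1p : 0 ≤ 1 - 1 / p := by rw [sub_nonneg, div_le_one hp0]; exact hp.le
  have hq : 1 ≤ ENNReal.ofReal p := by simpa using hp.le
  have hH := hv.memW1p.memLp_grad
  have hφW := fun n => (hφ n).memLp_gradient (by simp) (ENNReal.ofReal p)
  have hψW := fun n => (hψ n).memLp_gradient (by simp) (ENNReal.ofReal p)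
  set δ : ℕ → ℝ := fun n => 1 / ((n : ℝ) + 1) with hδ
  have hδ0 : ∀ n, 0 < δ n := fun n => by positivity
  have hS : ∀ n, IsCkc 1 Ω (fun x => powerMean p t (δ n) (φ n x) (ψ n x)) := fun n =>
    (hφ n).powerMean hp ht0 ht1 (hδ0 n) (hψ n)
  have lim : ∀ {χ : ℕ → EuclideanSpace ℝ (Fin N) → ℝ}
      {W : EuclideanSpace ℝ (Fin N) → EuclideanSpace ℝ (Fin N)}
      (_ : ∀ n, MemLp (gradient (χ n)) (ENNReal.ofReal p) (volume.restrict Ω))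
      (_ : MemLp W (ENNReal.ofReal p) (volume.restrict Ω))
      (_ : Tendsto (fun n => lpNorm (gradient (χ n) - W) (ENNReal.ofReal p) (volume.restrict Ω))
        atTop (𝓝 0)),
      Tendsto (fun n => ∫ x in Ω, ‖gradient (χ n) x‖ ^ p) atTop (𝓝 (∫ x in Ω, ‖W x‖ ^ p)) := by
    intro χ W h1 h2 h3
    simp only [← lpNorm_rpow_eq_integral hp0 (h1 _).1, ← lpNorm_rpow_eq_integral hp0 h2.1]
    exact (tendsto_lpNorm_of_tendsto_sub hq h1 h2 h3).rpow_const (Or.inr hp0.le)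
  refine integrable_and_integral_le_of_tendsto
    (g := fun n x => f x * powerMean p t (δ n) (φ n x) (ψ n x))
    (c := fun n => (1 - 1 / p) * (∫ x in Ω, ‖G x‖ ^ p) +
        1 / p * ((1 - t) * (∫ x in Ω, ‖gradient (φ n) x‖ ^ p) +
          t * ∫ x in Ω, ‖gradient (ψ n) x‖ ^ p))
    (fun n => (hS n).integrable_mul h.locallyIntegrable) (fun n => ?_) (fun n => ?_) ?_ ?_
  · filter_upwards [h.nonneg] with x hx
    exact mul_nonneg hx (powerMean_nonneg hp0 ht0 ht1 (hδ0 n).le _ _)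
  · have iG := h.memLp.integrable_norm_rpow_ofReal hp0
    have iφ := (hφW n).integrable_norm_rpow_ofReal hp0
    have iψ := (hψW n).integrable_norm_rpow_ofReal hp0
    rw [← h.integral_eq _ (hS n), ← integral_const_mul, ← integral_const_mul,
      ← integral_const_mul, ← integral_add (iφ.const_mul _) (iψ.const_mul _),
      ← integral_const_mul]
    refine le_of_le_of_eq ?_ (integral_add (iG.const_mul (1 - 1 / p))
        (((iφ.const_mul (1 - t)).add (iψ.const_mul t)).const_mul (1 / p)))
    refine integral_mono (integrable_norm_rpow_mul_inner hp h.memLp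
      ((hS n).memLp_gradient le_rfl _)) ((iG.const_mul _).add
        (((iφ.const_mul _).add (iψ.const_mul _)).const_mul _)) fun x => ?_
    refine (le_abs_self _).trans ((abs_norm_rpow_mul_inner_le hp _ _).trans ?_)
    obtain ⟨α, β, hα, hβ, hαβ, hle⟩ := exists_norm_gradient_powerMean_le hp ht0 ht1 (hδ0 n)
      ((hφ n).differentiable (by simp)) ((hψ n).differentiable (by simp)) x
    have y1 := rpow_mul_young hp hα (norm_nonneg (G x)) (norm_nonneg (gradient (φ n) x))
    have y2 := rpow_mul_young hp hβ (norm_nonneg (G x)) (norm_nonneg (gradient (ψ n) x))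
    have hg : 0 ≤ ‖G x‖ ^ p := by positivity
    calc ‖G x‖ ^ (p - 1) * _
        ≤ ‖G x‖ ^ (p - 1) * ((1 - t) * (α ^ (p - 1) * ‖gradient (φ n) x‖) +
            t * (β ^ (p - 1) * ‖gradient (ψ n) x‖)) := by gcongr
      _ = (1 - t) * (‖G x‖ ^ (p - 1) * (α ^ (p - 1) * ‖gradient (φ n) x‖)) +
            t * (‖G x‖ ^ (p - 1) * (β ^ (p - 1) * ‖gradient (ψ n) x‖)) := by ring
      _ ≤ (1 - t) * ((1 - 1 / p) * (α ^ p * ‖G x‖ ^ p) + 1 / p * ‖gradient (φ n) x‖ ^ p) +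
            t * ((1 - 1 / p) * (β ^ p * ‖G x‖ ^ p) + 1 / p * ‖gradient (ψ n) x‖ ^ p) := by gcongr
      _ = (1 - 1 / p) * (((1 - t) * α ^ p + t * β ^ p) * ‖G x‖ ^ p) +
            1 / p * ((1 - t) * ‖gradient (φ n) x‖ ^ p + t * ‖gradient (ψ n) x‖ ^ p) := by ring
      _ ≤ (1 - 1 / p) * (1 * ‖G x‖ ^ p) +
            1 / p * ((1 - t) * ‖gradient (φ n) x‖ ^ p + t * ‖gradient (ψ n) x‖ ^ p) := by gcongr
      _ = _ := by simp
  · exact tendsto_const_nhds.add ((((lim hφW h.memLp hφg).const_mul _).add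
      ((lim hψW hH hψg).const_mul _)).const_mul _)
  · filter_upwards [hφae, hψae] with x hx hy
    exact (tendsto_powerMean hp0 tendsto_one_div_add_atTop_nhds_zero_nat hx hy).const_mul _

/-- Picone's inequality `∫ |∇u| ^ (p - 2) ∇u · ∇(v ^ p / u ^ (p - 1)) ≤ ∫ |∇v| ^ p`, with the left
side expressed through the equation. It is the derivative at `t = 0` of `integral_mul_mean_le`. -/
lemma integral_mul_rpow_le (hp : 1 < p) (h : IsWeakPFlux p Ω G f)
    (hu : MemW1pZeroWithGradient p Ω u G) (hv : MemW1pZeroWithGradient p Ω v H)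
    (hu0 : ∀ᵐ x ∂(volume.restrict Ω), 0 < u x) (hv0 : ∀ᵐ x ∂(volume.restrict Ω), 0 < v x) :
    Integrable (fun x => f x * u x ^ (1 - p) * v x ^ p) (volume.restrict Ω) ∧
      ∫ x in Ω, f x * u x ^ (1 - p) * v x ^ p ≤ ∫ x in Ω, ‖H x‖ ^ p := by
  have hp0 : 0 < p := by linarith
  obtain ⟨hui, hue⟩ := h.integral_mul_self hp hu
  set A := ∫ x in Ω, ‖G x‖ ^ p with hA
  set B := ∫ x in Ω, ‖H x‖ ^ p with hB
  set t : ℕ → ℝ := fun n => 1 / ((n : ℝ) + 1) with ht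
  have ht0 : ∀ n, 0 < t n := fun n => by positivity
  have ht1 : ∀ n, t n ≤ 1 := fun n => by
    rw [ht, div_le_one (by positivity)]; linarith [Nat.cast_nonneg (α := ℝ) n]
  have hσ := fun n => h.integral_mul_mean_le hp hu hv (ht0 n).le (ht1 n)
  -- the difference quotients `(σ_t - u) / t`, shifted by `u` to make them nonnegative
  have key := integrable_and_integral_le_of_tendsto (μ := volume.restrict Ω)
    (g := fun n x => (t n)⁻¹ * (f x * ((1 - t n) * |u x| ^ p + t n * |v x| ^ p) ^ (1 / p)
      - f x * u x) + f x * u x)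
    (h := fun x => 1 / p * (f x * u x ^ (1 - p) * v x ^ p) + (1 - 1 / p) * (f x * u x))
    (c := fun n => 1 / p * (B - A) + A) (C := 1 / p * (B - A) + A)
    (fun n => (((hσ n).1.sub hui).const_mul _).add hui) (fun n => ?_) (fun n => ?_)
    tendsto_const_nhds ?_
  · have hP : Integrable (fun x => f x * u x ^ (1 - p) * v x ^ p) (volume.restrict Ω) := by
      refine ((key.1.sub (hui.const_mul (1 - 1 / p))).const_mul p).congr (ae_of_all _ fun x => ?_)
      simp only [Pi.sub_apply]; field_simp; ring
    refine ⟨hP, ?_⟩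
    have k2 := key.2
    rw [integral_add (hP.const_mul _) (hui.const_mul _), integral_const_mul, integral_const_mul,
      hue] at k2
    have : 1 / p * ∫ x in Ω, f x * u x ^ (1 - p) * v x ^ p ≤ 1 / p * B := by linarith
    exact le_of_mul_le_mul_left this (by positivity)
  · filter_upwards [h.nonneg, hu0] with x hf hx
    have hle := mul_le_weighted_mean hp.le (ht0 n).le (ht1 n) hx.le (v x)
    set σ := ((1 - t n) * |u x| ^ p + t n * |v x| ^ p) ^ (1 / p) with hσx
    have h1 : 0 ≤ (t n)⁻¹ * (σ - (1 - t n) * u x) :=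
      mul_nonneg (inv_nonneg.2 (ht0 n).le) (sub_nonneg.2 hle)
    have h2 : (t n)⁻¹ * (f x * σ - f x * u x) + f x * u x =
        f x * ((t n)⁻¹ * (σ - (1 - t n) * u x)) := by
      have := (ht0 n).ne'
      field_simp; ring
    change 0 ≤ (t n)⁻¹ * (f x * σ - f x * u x) + f x * u x
    rw [h2]
    exact mul_nonneg hf h1
  · have hi : Integrable (fun x => f x * ((1 - t n) * |u x| ^ p + t n * |v x| ^ p) ^ (1 / p)
        - f x * u x) (volume.restrict Ω) := (hσ n).1.sub hui
    rw [integral_add (hi.const_mul _) hui, integral_const_mul,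
      integral_sub (hσ n).1 hui, hue]
    have h1 := mul_le_mul_of_nonneg_left (sub_le_sub_right (hσ n).2 A) (inv_nonneg.2 (ht0 n).le)
    have h2 : (t n)⁻¹ * ((1 - 1 / p) * A + 1 / p * ((1 - t n) * A + t n * B) - A)
        = 1 / p * (B - A) := by
      have := (ht0 n).ne'
      field_simp; ring
    linarith
  · filter_upwards [hu0, hv0] with x hx hy
    have ht : Tendsto t atTop (𝓝[≠] 0) := tendsto_nhdsWithin_iff.2
      ⟨tendsto_one_div_add_atTop_nhds_zero_nat, Eventually.of_forall fun n => (ht0 n).ne'⟩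
    have hl := ((tendsto_weighted_mean_slope hp0 hx (v x) ht).const_mul (f x)).add_const (f x * u x)
    have e : u x ^ (1 - p) * u x ^ p = u x := by
      rw [← Real.rpow_add hx, sub_add_cancel, Real.rpow_one]
    convert hl using 2
    · ring
    · rw [abs_of_pos hy]
      linear_combination (1 / p * f x) * e

end IsWeakPFlux
end WeakSolution

/-! ### Uniqueness -/

theorem atMostOneWeakSolution_of_strictAntiOn {N : ℕ} {p : ℝ} (hp : 1 < p)
    {Ω : Set (EuclideanSpace ℝ (Fin N))} {F : EuclideanSpace ℝ (Fin N) → ℝ → ℝ}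
    (hF0 : ∀ᵐ x ∂(volume.restrict Ω), ∀ s : ℝ, 0 < s → 0 ≤ F x s)
    (hF : ∀ᵐ x ∂(volume.restrict Ω), StrictAntiOn (fun s : ℝ => F x s * s ^ (1 - p)) (Ioi 0)) :
    AtMostOneWeakSolution p Ω F := by
  rintro u v ⟨hu0, hul, G, hu, hue⟩ ⟨hv0, hvl, H, hv, hve⟩
  have hG : IsWeakPFlux p Ω G (fun x => F x (u x)) :=
    ⟨hu.memW1p.memLp_grad, hul, by filter_upwards [hF0, hu0] with x h hx using h _ hx, hue⟩
  have hH : IsWeakPFlux p Ω H (fun x => F x (v x)) :=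
    ⟨hv.memW1p.memLp_grad, hvl, by filter_upwards [hF0, hv0] with x h hx using h _ hx, hve⟩
  obtain ⟨iu, eu⟩ := hG.integral_mul_self hp hu
  obtain ⟨iv, ev⟩ := hH.integral_mul_self hp hv
  obtain ⟨iuv, euv⟩ := hG.integral_mul_rpow_le hp hu hv hu0 hv0
  obtain ⟨ivu, evu⟩ := hH.integral_mul_rpow_le hp hv hu hv0 hu0
  -- `D = (f_u u ^ (1 - p) - f_v v ^ (1 - p)) (v ^ p - u ^ p)`, expanded into integrable pieces
  set D : EuclideanSpace ℝ (Fin N) → ℝ := fun x =>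
    (F x (u x) * u x ^ (1 - p) * v x ^ p - F x (v x) * v x) +
      (F x (v x) * v x ^ (1 - p) * u x ^ p - F x (u x) * u x) with hD
  have iD : Integrable D (volume.restrict Ω) := (iuv.sub iv).add (ivu.sub iu)
  have hDe : ∀ x, 0 < u x → 0 < v x →
      D x = (F x (u x) * u x ^ (1 - p) - F x (v x) * v x ^ (1 - p)) * (v x ^ p - u x ^ p) := by
    intro x hx hy
    have e : ∀ s : ℝ, 0 < s → s ^ (1 - p) * s ^ p = s := fun s hs => by
      rw [← Real.rpow_add hs, sub_add_cancel, Real.rpow_one]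
    simp only [hD]
    linear_combination F x (v x) * e _ hy + F x (u x) * e _ hx
  have hDpos : ∀ᵐ x ∂(volume.restrict Ω), 0 ≤ D x ∧ (D x = 0 → u x = v x) := by
    filter_upwards [hu0, hv0, hF] with x hx hy hanti
    rw [hDe x hx hy]
    rcases lt_trichotomy (u x) (v x) with h | h | h
    · have h1 := hanti hx hy h
      have h2 := Real.rpow_lt_rpow hx.le h (by linarith : 0 < p)
      have := mul_pos (sub_pos.2 h1) (sub_pos.2 h2)
      exact ⟨this.le, fun h0 => absurd h0 this.ne'⟩
    · simp [h]
    · have h1 := hanti hy hx h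
      have h2 := Real.rpow_lt_rpow hy.le h (by linarith : 0 < p)
      have := mul_pos_of_neg_of_neg (sub_neg.2 h1) (sub_neg.2 h2)
      exact ⟨this.le, fun h0 => absurd h0 this.ne'⟩
  have hDint : ∫ x in Ω, D x ≤ 0 := by
    have : ∫ x in Ω, D x = ((∫ x in Ω, F x (u x) * u x ^ (1 - p) * v x ^ p) -
        ∫ x in Ω, F x (v x) * v x) + ((∫ x in Ω, F x (v x) * v x ^ (1 - p) * u x ^ p) -
          ∫ x in Ω, F x (u x) * u x) := by
      rw [← integral_sub iuv iv, ← integral_sub ivu iu]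
      exact integral_add (iuv.sub iv) (ivu.sub iu)
    linarith
  have hD0 : 0 ≤ᵐ[volume.restrict Ω] D := hDpos.mono fun x hx => hx.1
  have hDz := (integral_eq_zero_iff_of_nonneg_ae hD0 iD).1
    (le_antisymm hDint (integral_nonneg_of_ae hD0))
  filter_upwards [hDz, hDpos] with x h1 h2 using h2.2 h1

lemma strictAntiOn_singular_add_power {a b γ q p : ℝ} (hp : 1 < p) (ha : 0 ≤ a) (hb : 0 ≤ b)
    (hγ : 0 ≤ γ) (hq : q ≤ p - 1) (h : 0 < a ∨ 0 < b ∧ q < p - 1) :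
    StrictAntiOn (fun s : ℝ => (a / s ^ γ + b * s ^ q) * s ^ (1 - p)) (Ioi 0) := by
  intro s hs r hr hsr
  have hs0 : 0 < s := hs
  have hr0 : 0 < r := hr
  have e : ∀ x : ℝ, 0 < x → (a / x ^ γ + b * x ^ q) * x ^ (1 - p) =
      a * x ^ (1 - p - γ) + b * x ^ (q + 1 - p) := fun x hx => by
    rw [Real.rpow_sub hx (1 - p) γ, show q + 1 - p = q + (1 - p) by ring, Real.rpow_add hx]
    ring
  simp only [e s hs0, e r hr0]
  have h1 : r ^ (1 - p - γ) < s ^ (1 - p - γ) :=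
    Real.rpow_lt_rpow_of_neg hs0 hsr (by linarith)
  have h2 : r ^ (q + 1 - p) ≤ s ^ (q + 1 - p) :=
    Real.rpow_le_rpow_of_nonpos hs0 hsr.le (by linarith)
  rcases h with ha | ⟨hb, hq⟩
  · exact add_lt_add_of_lt_of_le (mul_lt_mul_of_pos_left h1 ha) (mul_le_mul_of_nonneg_left h2 hb)
  · exact add_lt_add_of_le_of_lt (mul_le_mul_of_nonneg_left h1.le ha)
      (mul_lt_mul_of_pos_left (Real.rpow_lt_rpow_of_neg hs0 hsr (by linarith)) hb)

theorem corollary2p2 {N : ℕ} {p : ℝ} (hp : 1 < p) (hpN : p < (N : ℝ))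
    {Ω : Set (EuclideanSpace ℝ (Fin N))} (hΩ : IsOpen Ω) (hΩb : Bornology.IsBounded Ω) :
    (∀ F : EuclideanSpace ℝ (Fin N) → ℝ → ℝ, IsCaratheodory Ω F →
      (∀ᵐ x ∂(volume.restrict Ω), ∀ s : ℝ, 0 < s → 0 ≤ F x s) →
      (∀ᵐ x ∂(volume.restrict Ω), StrictAntiOn (fun s : ℝ => F x s * s ^ (1 - p)) (Ioi 0)) →
      AtMostOneWeakSolution p Ω F) ∧
    (∀ (f g : EuclideanSpace ℝ (Fin N) → ℝ) (γ q : ℝ),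
      AEMeasurable f (volume.restrict Ω) → AEMeasurable g (volume.restrict Ω) →
      (∀ᵐ x ∂(volume.restrict Ω), 0 ≤ f x) → (∀ᵐ x ∂(volume.restrict Ω), 0 ≤ g x) →
      (∀ᵐ x ∂(volume.restrict Ω), 0 < f x + g x) →
      0 ≤ γ → 0 ≤ q → q < p - 1 →
      AtMostOneWeakSolution p Ω (fun x s => f x / s ^ γ + g x * s ^ q)) ∧
    (∀ (f g : EuclideanSpace ℝ (Fin N) → ℝ) (γ : ℝ),
      AEMeasurable f (volume.restrict Ω) → AEMeasurable g (volume.restrict Ω) →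
      (∀ᵐ x ∂(volume.restrict Ω), 0 < f x) → (∀ᵐ x ∂(volume.restrict Ω), 0 ≤ g x) →
      0 ≤ γ →
      AtMostOneWeakSolution p Ω (fun x s => f x / s ^ γ + g x * s ^ (p - 1))) := by

  refine ⟨fun F _ hF0 hF => atMostOneWeakSolution_of_strictAntiOn hp hF0 hF, ?_, ?_⟩
  · intro f g γ q _ _ hf hg hfg hγ _ hq
    refine atMostOneWeakSolution_of_strictAntiOn hp ?_ ?_
    · filter_upwards [hf, hg] with x hfx hgx s hs
      positivity
    · filter_upwards [hf, hg, hfg] with x hfx hgx hx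
      refine strictAntiOn_singular_add_power hp hfx hgx hγ hq.le ?_
      rcases hfx.lt_or_eq with h | h
      · exact Or.inl h
      · exact Or.inr ⟨by linarith, hq⟩
  · intro f g γ _ _ hf hg hγ
    refine atMostOneWeakSolution_of_strictAntiOn hp ?_ ?_
    · filter_upwards [hf, hg] with x hfx hgx s hs
      positivity
    · filter_upwards [hf, hg] with x hfx hgx
      exact strictAntiOn_singular_add_power hp hfx.le hgx hγ le_rfl (Or.inl hfx)
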